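/- In the Prophet Secretary problem, an instance consists of a number $n$ and the probability distributions of $n$ independent non-negative random variables $X_1,\dots,X_n$. Knowing $n$ and these distributions, an algorithm chooses thresholds $\alpha_1,\dots,\alpha_n\ge 0$. Samples $x_1\sim X_1,\dots,x_n\sim X_n$ are drawn independently and arrive in the order $x_{\sigma(1)},\dots,x_{\sigma(n)}$, where $\sigma$ is a uniformly random permutation of $\{1,\dots,n\}$, independent of the samples; the algorithm knows neither $\sigma$ nor the rejected values. Its profit is $x_{\sigma(k)}$ for the smallest $k$ with $x_{\sigma(k)}\ge\alpha_k$, and $0$ if there is no such $k$. The algorithm is $c$-competitive if, for every $n$ and on every instance, its expected profit (over $\sigma$ and the samples) is at least $c\cdot\mathbb{E}[\max_i X_i]$. Theorem. There are a constant $c>1-\frac1e+\frac1{400}$ and an algorithm for the Prophet Secretary problem that is $c$-competitive. -/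

import Mathlib

open MeasureTheory
open scoped ENNReal NNReal

namespace ProphetSecretary

/-- An instance with `n` variables: the probability distributions on `[0, ∞)` of the
independent non-negative random variables `X₁, …, Xₙ`. -/
abbrev Instance (n : ℕ) : Type := Fin n → ProbabilityMeasure ℝ≥0

/-- The joint law of the independent samples `x₁ ∼ X₁, …, xₙ ∼ Xₙ`. -/
noncomputable def Instance.law {n : ℕ} (X : Instance n) : Measure (Fin n → ℝ≥0) :=
  Measure.pi fun i => (X i : Measure ℝ≥0)

/-- The benchmark `E[maxᵢ Xᵢ]` (the maximum over no variables is `0`). -/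
noncomputable def Instance.benchmark {n : ℕ} (X : Instance n) : ℝ≥0∞ :=
  ∫⁻ x, ((Finset.univ.sup x : ℝ≥0) : ℝ≥0∞) ∂X.law

/-- A (deterministic) algorithm for the prophet secretary problem. It is given the number of
variables and all their distributions, and declares a threshold for every round. While it runs it
learns neither the arrival order nor the values that it rejects, so in round `k` it knows only
that the first `k - 1` samples were rejected, and its thresholds are functions of the instance and
of the round alone. -/
structure Algorithm where
  threshold : (n : ℕ) → Instance n → Fin n → ℝ≥0

/-- The sample arriving in round `k` is `x (σ k)`. It is picked when it reaches the threshold `α k`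
and every sample that arrived earlier fell short of its threshold. -/
def Picks {n : ℕ} (α : Fin n → ℝ≥0) (σ : Equiv.Perm (Fin n)) (x : Fin n → ℝ≥0) (k : Fin n) :
    Prop :=
  α k ≤ x (σ k) ∧ ∀ j < k, x (σ j) < α j

open scoped Classical in
/-- The profit from round `k`: the value of the sample if it is picked, and `0` otherwise. -/
noncomputable def roundProfit {n : ℕ} (α : Fin n → ℝ≥0) (σ : Equiv.Perm (Fin n))
    (x : Fin n → ℝ≥0) (k : Fin n) : ℝ≥0 :=
  if Picks α σ x k then x (σ k) else 0

/-- The profit for the arrival order `σ` and the samples `x`. At most one round contributes. -/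
noncomputable def profit {n : ℕ} (α : Fin n → ℝ≥0) (σ : Equiv.Perm (Fin n)) (x : Fin n → ℝ≥0) :
    ℝ≥0 :=
  ∑ k, roundProfit α σ x k

/-- The expected profit on the instance `X`, over a uniformly random arrival order and,
independently of it, over the samples. -/
noncomputable def Algorithm.expectedProfit (A : Algorithm) {n : ℕ} (X : Instance n) : ℝ≥0∞ :=
  (∑ σ : Equiv.Perm (Fin n), ∫⁻ x, (profit (A.threshold n X) σ x : ℝ≥0∞) ∂X.law) /
    (n.factorial : ℝ≥0∞)

/-- `A` has competitive ratio (at least) `c`: on every instance, its expected profit is at least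
`c` times the expected maximum. -/
def Algorithm.IsCompetitive (A : Algorithm) (c : ℝ) : Prop :=
  ∀ (n : ℕ) (X : Instance n), ENNReal.ofReal c * X.benchmark ≤ A.expectedProfit X

end ProphetSecretary

namespace ProphetSecretary

/-! Give each sample an independent uniform arrival time in [0, 1] and an independent random
threshold, within ε of v₁ before time 1/2 and within ε of a lower level v₂ ≤ v₁ afterwards. Sorting
by time yields a uniformly random order, so some deterministic threshold sequence does at least
about as well as these random marks (`exists_thresholds`). The threshold laws are tuned so that all
samples would be rejected with probability exp(-0.9) under the first law and exp(-1.2) under the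
second; randomizing over two adjacent grid points makes this exact even when the distributions have
atoms.

Let p i and r i be the acceptance probabilities of sample i under the two laws. An accepted sample
pays its phase level plus its excess over that level, up to ε. The excess part needs a lower bound
on the probability that the other samples leave the algorithm running at a given time. Weighted
AM-GM bounds it below by an exponential independent of i (`rpow_prod_mul_rpow_prod_le`), and
integrating over the phases gives I₁ and I₂. The level part needs the probabilities S₁, S₂ of
stopping in each phase. They are differences of products, bounded through a correlation inequality
(`prod_affine_le_affine_prod`).

The maximum is cut at v₂ and v₁. The piece below v₂ is paid by S₁ + S₂, the piece above v₁ by I₁ +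
I₂, and the piece between by S₁ and I₂, since the maximum exceeds v₂ + ε with probability at most 1
- exp(-1.2). All three rates are at least 0.64 (`combine_phases`, `two_phase_numerics`). A single
phase with parameter L has the two rates (1 - exp(-L)) / L and 1 - exp(-L), balanced at L = 1 with
value 1 - 1/e; parameters on either side of 1 improve both. -/

/-! ### Marked samples and derandomization -/

/-- The value of a sample whose mark (arrival time and threshold) accepts it, and `0` otherwise. -/
noncomputable def gain (z : (ℝ × ℝ≥0) × ℝ≥0) : ℝ≥0∞ := if z.1.2 ≤ z.2 then (z.2 : ℝ≥0∞) else 0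

/-- Whether a marked sample leaves the algorithm running at time `u`, as an indicator. -/
noncomputable def pass (u : ℝ) (z : (ℝ × ℝ≥0) × ℝ≥0) : ℝ≥0∞ :=
  if z.1.1 ≤ u ∧ z.1.2 ≤ z.2 then 0 else 1

/-- The profit when every sample carries its own arrival time and threshold; nothing is picked in
case of a tie. -/
noncomputable def markedProfit {n : ℕ} (z : Fin n → (ℝ × ℝ≥0) × ℝ≥0) : ℝ≥0∞ :=
  ∑ i, gain (z i) * ∏ j ∈ Finset.univ.erase i, pass (z i).1.1 (z j)

/-- If round k does not pick, either its sample misses the threshold, so `gain` vanishes, or some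
earlier round accepts, so a `pass` factor vanishes. Equality can fail only through ties in time. -/
lemma markedProfit_le_profit {n : ℕ} (s : Fin n → ℝ × ℝ≥0) (hs : Monotone fun k => (s k).1)
    (σ : Equiv.Perm (Fin n)) (x : Fin n → ℝ≥0) :
    markedProfit (fun i => (s (σ⁻¹ i), x i)) ≤ (profit (fun k => (s k).2) σ x : ℝ≥0) := by
  unfold markedProfit profit
  rw [ENNReal.ofNNReal_finsetSum, ← Equiv.sum_comp σ]
  refine Finset.sum_le_sum fun k _ => ?_
  by_cases h : Picks (fun k => (s k).2) σ x k
  · rw [roundProfit, if_pos h]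
    refine (mul_le_mul' (b := ((x (σ k) : ℝ≥0) : ℝ≥0∞)) (d := 1) ?_ ?_).trans (by simp)
    · unfold gain; split_ifs <;> simp
    · refine Finset.prod_le_one' fun j _ => ?_
      unfold pass; split_ifs <;> simp
  · suffices gain (s (σ⁻¹ (σ k)), x (σ k)) *
        ∏ j ∈ Finset.univ.erase (σ k), pass (s (σ⁻¹ (σ k))).1 (s (σ⁻¹ j), x j) = 0 by
      rw [this]; exact zero_le
    simp only [Picks, not_and_or, not_forall, not_lt, not_le] at h
    rcases h with h | ⟨j, hj, h⟩
    · simp [gain, h]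
    · refine mul_eq_zero_of_right _ (Finset.prod_eq_zero (i := σ j) ?_ ?_)
      · simpa using hj.ne
      · have := hs hj.le
        simp_all [pass]

lemma measurable_gain : Measurable gain :=
  Measurable.ite (measurableSet_le (by fun_prop) (by fun_prop)) (by fun_prop) (by fun_prop)

lemma measurable_pass :
    Measurable fun p : ℝ × ((ℝ × ℝ≥0) × ℝ≥0) => pass p.1 p.2 :=
  Measurable.ite ((measurableSet_le (f := fun p : ℝ × ((ℝ × ℝ≥0) × ℝ≥0) => p.2.1.1) (g := Prod.fst)
    (by fun_prop) (by fun_prop)).inter (measurableSet_le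
      (f := fun p : ℝ × ((ℝ × ℝ≥0) × ℝ≥0) => p.2.1.2) (g := fun p => p.2.2)
      (by fun_prop) (by fun_prop))) (by fun_prop) (by fun_prop)

lemma measurable_markedProfit {n : ℕ} : Measurable (markedProfit (n := n)) := by
  unfold markedProfit
  refine Finset.measurable_sum _ fun i _ => (measurable_gain.comp (measurable_pi_apply i)).mul ?_
  refine Finset.measurable_prod _ fun j _ => ?_
  exact measurable_pass.comp (f := fun z : Fin n → (ℝ × ℝ≥0) × ℝ≥0 => ((z i).1.1, z j))
    (by fun_prop)

instance {n : ℕ} (X : Instance n) : IsProbabilityMeasure X.law := by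
  unfold Instance.law; infer_instance

/-- Random marks do no better than the best deterministic thresholds. -/
lemma exists_thresholds {n : ℕ} (X : Instance n) (μ : Measure (ℝ × ℝ≥0)) [IsProbabilityMeasure μ]
    {L : ℝ≥0∞}
    (hL : L < ∫⁻ s, ∫⁻ x, markedProfit (fun i => (s i, x i)) ∂X.law ∂(Measure.pi fun _ => μ)) :
    ∃ α : Fin n → ℝ≥0,
      L ≤ (∑ σ : Equiv.Perm (Fin n), ∫⁻ x, (profit α σ x : ℝ≥0∞) ∂X.law) / (n.factorial : ℝ≥0∞) := by
  set F : (Fin n → ℝ × ℝ≥0) → ℝ≥0∞ := fun s => ∫⁻ x, markedProfit (fun i => (s i, x i)) ∂X.law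
    with hF
  have hFm : Measurable F := by
    refine Measurable.lintegral_prod_right' (f := fun p : (Fin n → ℝ × ℝ≥0) × (Fin n → ℝ≥0) =>
      markedProfit fun i => (p.1 i, p.2 i)) ?_
    exact measurable_markedProfit.comp (by fun_prop)
  -- The marks are i.i.d., hence exchangeable, so `F` may be averaged over all relabellings.
  have hinv (σ : Equiv.Perm (Fin n)) :
      ∫⁻ s, F (s ∘ σ) ∂(Measure.pi fun _ => μ) = ∫⁻ s, F s ∂(Measure.pi fun _ => μ) := by
    have h := measurePreserving_arrowCongr' (μ := fun _ : Fin n => μ) (ν := fun _ : Fin n => μ)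
      σ.symm (MeasurableEquiv.refl _) (fun _ => MeasurePreserving.id μ)
    rw [← h.lintegral_comp hFm]
    rfl
  by_contra! hcon
  refine absurd hL (not_lt.2 ?_)
  have hfac : (n.factorial : ℝ≥0∞) ≠ 0 := by exact_mod_cast n.factorial_ne_zero
  have hsum : ∫⁻ s, F s ∂(Measure.pi fun _ => μ) =
      ∫⁻ s, (∑ σ : Equiv.Perm (Fin n), F (s ∘ σ)) / (n.factorial : ℝ≥0∞)
        ∂(Measure.pi fun _ => μ) := by
    simp_rw [div_eq_mul_inv]
    have hFσ (σ : Equiv.Perm (Fin n)) : Measurable fun s => F (s ∘ σ) :=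
      hFm.comp (g := F) (f := fun s : Fin n → ℝ × ℝ≥0 => s ∘ σ)
        (measurable_pi_lambda _ fun i => measurable_pi_apply _)
    rw [lintegral_mul_const _ (Finset.measurable_sum _ fun σ _ => hFσ σ),
      lintegral_finsetSum _ (fun σ _ => hFσ σ)]
    simp_rw [hinv]
    rw [Finset.sum_const, Finset.card_univ, Fintype.card_perm, Fintype.card_fin, nsmul_eq_mul,
      mul_comm, ← mul_assoc, ENNReal.inv_mul_cancel hfac (ENNReal.natCast_ne_top _), one_mul]
  rw [hsum]
  calc _ ≤ ∫⁻ _, L ∂(Measure.pi fun _ : Fin n => μ) := lintegral_mono fun s => ?_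
    _ = L := by simp
  set ρ := Tuple.sort fun k => (s k).1 with hρ
  have hmono : Monotone fun k => (s (ρ k)).1 := Tuple.monotone_sort fun k => (s k).1
  refine le_trans ?_ (hcon fun k => (s (ρ k)).2).le
  refine ENNReal.div_le_div_right ?_ _
  -- Substituting ρ * σ⁻¹ for the relabelling gives sample i the mark of rank σ⁻¹ i, which is the
  -- round in which it arrives under σ.
  rw [← Equiv.sum_comp ((Equiv.inv (Equiv.Perm (Fin n))).trans (Equiv.mulLeft ρ))]
  refine Finset.sum_le_sum fun σ _ => lintegral_mono fun x => ?_
  exact markedProfit_le_profit (fun k => s (ρ k)) hmono σ x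

/-! ### Expected profit as an integral over one marked sample -/

lemma _root_.Fin.prod_univ_erase {n : ℕ} {M : Type*} [CommMonoid M] (i : Fin (n + 1))
    (f : Fin (n + 1) → M) :
    ∏ j ∈ Finset.univ.erase i, f j = ∏ j, f (i.succAbove j) := by
  rw [← Finset.compl_singleton, ← Fin.image_succAbove_univ,
    Finset.prod_image fun _ _ _ _ h => Fin.succAbove_right_injective h]

/-- Tonelli for a product of pairwise interactions with one fixed coordinate. -/
lemma lintegral_pi_mul_prod_erase {n : ℕ} {Z : Type*} [MeasurableSpace Z] (ν : Fin n → Measure Z)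
    [∀ i, IsProbabilityMeasure (ν i)] {f : Z → ℝ≥0∞} (hf : Measurable f) {g : Z × Z → ℝ≥0∞}
    (hg : Measurable g) (i : Fin n) :
    ∫⁻ z, f (z i) * ∏ j ∈ Finset.univ.erase i, g (z i, z j) ∂(Measure.pi ν) =
      ∫⁻ y, f y * ∏ j ∈ Finset.univ.erase i, ∫⁻ w, g (y, w) ∂(ν j) ∂(ν i) := by
  obtain _ | n := n
  · exact i.elim0
  simp_rw [Fin.prod_univ_erase]
  have hm : Measurable fun p : Z × (Fin n → Z) => f p.1 * ∏ j, g (p.1, p.2 j) :=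
    (hf.comp measurable_fst).mul (Finset.measurable_prod _ fun j _ => hg.comp (by fun_prop))
  have h := (measurePreserving_piFinSuccAbove ν i).lintegral_comp hm
  refine Eq.trans ?_ (h.trans ?_)
  · rfl
  rw [lintegral_prod _ hm.aemeasurable]
  refine lintegral_congr fun y => ?_
  have hgy (j : Fin n) : Measurable fun w : Z => g (y, w) := hg.comp (by fun_prop)
  have hgw (j : Fin n) : Measurable fun w : Fin n → Z => g (y, w j) :=
    (hgy j).comp (measurable_pi_apply j)
  dsimp only
  rw [lintegral_const_mul _ (Finset.measurable_prod _ fun j _ => hgw j)]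
  congr 1
  have := ProbabilityTheory.lintegral_prod_eq_prod_lintegral_of_indepFun Finset.univ
    (fun j (w : Fin n → Z) => g (y, w j))
    (ProbabilityTheory.iIndepFun_pi (μ := fun j => ν (i.succAbove j))
      (X := fun j w => g (y, w)) fun j => (hgy j).aemeasurable)
    hgw
  rw [this]
  refine Finset.prod_congr rfl fun j _ => ?_
  exact (measurePreserving_eval (fun j => ν (i.succAbove j)) j).lintegral_comp (hgy j)

/-- The pairs of mark and value are independent across samples, so conditioning on the pair of
sample i makes the survival probability factor over the others. -/
lemma lintegral_markedProfit {n : ℕ} (X : Instance n) (μ : Measure (ℝ × ℝ≥0))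
    [IsProbabilityMeasure μ] :
    ∫⁻ s, ∫⁻ x, markedProfit (fun i => (s i, x i)) ∂X.law ∂(Measure.pi fun _ => μ) =
      ∑ i, ∫⁻ z, gain z * ∏ j ∈ Finset.univ.erase i, ∫⁻ w, pass z.1.1 w ∂(μ.prod (X j))
        ∂(μ.prod (X i)) := by
  have hm : Measurable fun p : (Fin n → ℝ × ℝ≥0) × (Fin n → ℝ≥0) =>
      markedProfit (fun i => (p.1 i, p.2 i)) := measurable_markedProfit.comp (by fun_prop)
  rw [← lintegral_prod (fun p : (Fin n → ℝ × ℝ≥0) × (Fin n → ℝ≥0) =>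
    markedProfit (fun i => (p.1 i, p.2 i))) hm.aemeasurable]
  have h := (measurePreserving_arrowProdEquivProdArrow (ℝ × ℝ≥0) ℝ≥0 (Fin n) (fun _ => μ)
    (fun i => (X i : Measure ℝ≥0))).lintegral_comp hm
  rw [Instance.law, ← h]
  have hp : Measurable fun p : ((ℝ × ℝ≥0) × ℝ≥0) × ((ℝ × ℝ≥0) × ℝ≥0) => pass p.1.1.1 p.2 :=
    measurable_pass.comp
      (f := fun p : ((ℝ × ℝ≥0) × ℝ≥0) × ((ℝ × ℝ≥0) × ℝ≥0) => (p.1.1.1, p.2)) (by fun_prop)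
  calc _ = ∫⁻ z, markedProfit z ∂(Measure.pi fun i => μ.prod (X i)) := rfl
    _ = _ := ?_
  unfold markedProfit
  have hpij (i j : Fin n) : Measurable fun z : Fin n → (ℝ × ℝ≥0) × ℝ≥0 =>
      pass (z i).1.1 (z j) :=
    hp.comp (f := fun z : Fin n → (ℝ × ℝ≥0) × ℝ≥0 => (z i, z j)) (by fun_prop)
  have hgi (i : Fin n) : Measurable fun z : Fin n → (ℝ × ℝ≥0) × ℝ≥0 => gain (z i) :=
    measurable_gain.comp (measurable_pi_apply i)
  have hi (i : Fin n) : Measurable fun z : Fin n → (ℝ × ℝ≥0) × ℝ≥0 =>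
      gain (z i) * ∏ j ∈ Finset.univ.erase i, pass (z i).1.1 (z j) :=
    (hgi i).mul (Finset.measurable_prod _ fun j _ => hpij i j)
  rw [lintegral_finsetSum _ fun i _ => hi i]
  exact Finset.sum_congr rfl fun i _ =>
    lintegral_pi_mul_prod_erase (fun i => μ.prod (X i)) measurable_gain hp i

/-! ### Two-phase marks -/

/-- Marks for two phases: the time is uniform on `[0, 1]`, and the threshold has law `ν₁` up to
time `a` and `ν₂` after it. -/
noncomputable def twoPhase (a : ℝ) (ν₁ ν₂ : Measure ℝ≥0) : Measure (ℝ × ℝ≥0) :=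
  (volume.restrict (Set.Icc 0 a)).prod ν₁ + (volume.restrict (Set.Ioc a 1)).prod ν₂

lemma isProbabilityMeasure_twoPhase {a : ℝ} (h0 : 0 ≤ a) (h1 : a ≤ 1) (ν₁ ν₂ : Measure ℝ≥0)
    [IsProbabilityMeasure ν₁] [IsProbabilityMeasure ν₂] :
    IsProbabilityMeasure (twoPhase a ν₁ ν₂) := by
  constructor
  simp only [twoPhase, Measure.add_apply, ← Set.univ_prod_univ, Measure.prod_prod, measure_univ,
    mul_one, Measure.restrict_apply, MeasurableSet.univ, Set.univ_inter, Real.volume_Icc,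
    Real.volume_Ioc]
  rw [← ENNReal.ofReal_add (by linarith) (by linarith)]
  simp

/-- The expected value of a sample of law `X` that is accepted by a threshold of law `ν`. -/
noncomputable def acceptedValue (ν X : Measure ℝ≥0) : ℝ≥0∞ :=
  ∫⁻ y, (if y.1 ≤ y.2 then (y.2 : ℝ≥0∞) else 0) ∂(ν.prod X)

/-- The probability that a sample of law `X` is accepted by a threshold of law `ν`. -/
noncomputable def acceptProb (ν X : Measure ℝ≥0) : ℝ :=
  (ν.prod X).real {y | y.1 ≤ y.2}

lemma measurable_accepted : Measurable fun y : ℝ≥0 × ℝ≥0 => if y.1 ≤ y.2 then (y.2 : ℝ≥0∞) else 0 :=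
  Measurable.ite (measurableSet_le (by fun_prop) (by fun_prop)) (by fun_prop) (by fun_prop)

lemma lintegral_gain_mul_prod (τ : Measure ℝ) (ν X : Measure ℝ≥0) [SFinite τ]
    [IsProbabilityMeasure ν] [IsProbabilityMeasure X] {F : ℝ → ℝ≥0∞} (hF : Measurable F) :
    ∫⁻ z, gain z * F z.1.1 ∂((τ.prod ν).prod X) = acceptedValue ν X * ∫⁻ u, F u ∂τ := by
  have hm : Measurable fun z : (ℝ × ℝ≥0) × ℝ≥0 => gain z * F z.1.1 :=
    measurable_gain.mul (hF.comp (by fun_prop))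
  have hg (m : ℝ × ℝ≥0) : Measurable fun x : ℝ≥0 => gain (m, x) :=
    measurable_gain.comp (by fun_prop)
  rw [lintegral_prod _ hm.aemeasurable, acceptedValue,
    lintegral_prod _ measurable_accepted.aemeasurable, mul_comm,
    ← lintegral_prod_mul hF.aemeasurable measurable_accepted.lintegral_prod_right'.aemeasurable]
  refine lintegral_congr fun m => ?_
  dsimp only
  rw [lintegral_mul_const _ (hg m), mul_comm]
  rfl

lemma lintegral_gain_mul_twoPhase (a : ℝ) (ν₁ ν₂ X : Measure ℝ≥0)
    [IsProbabilityMeasure ν₁] [IsProbabilityMeasure ν₂] [IsProbabilityMeasure X] {F : ℝ → ℝ≥0∞}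
    (hF : Measurable F) :
    ∫⁻ z, gain z * F z.1.1 ∂((twoPhase a ν₁ ν₂).prod X) =
      acceptedValue ν₁ X * (∫⁻ u in Set.Icc 0 a, F u) +
        acceptedValue ν₂ X * ∫⁻ u in Set.Ioc a 1, F u := by
  rw [twoPhase, Measure.add_prod, lintegral_add_measure, lintegral_gain_mul_prod _ _ _ hF,
    lintegral_gain_mul_prod _ _ _ hF]

lemma acceptProb_nonneg (ν X : Measure ℝ≥0) : 0 ≤ acceptProb ν X := measureReal_nonneg

lemma acceptProb_le_one (ν X : Measure ℝ≥0) [IsProbabilityMeasure ν] [IsProbabilityMeasure X] :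
    acceptProb ν X ≤ 1 := measureReal_le_one

lemma measure_accept_prod (τ : Measure ℝ) (ν X : Measure ℝ≥0) [SFinite τ]
    [IsProbabilityMeasure ν] [IsProbabilityMeasure X] (u : ℝ) :
    ((τ.prod ν).prod X) {z | z.1.1 ≤ u ∧ z.1.2 ≤ z.2} =
      τ (Set.Iic u) * ENNReal.ofReal (acceptProb ν X) := by
  have h : (τ.prod (ν.prod X)) (Set.Iic u ×ˢ {y | y.1 ≤ y.2}) =
      τ (Set.Iic u) * ENNReal.ofReal (acceptProb ν X) := by
    rw [Measure.prod_prod, acceptProb, ofReal_measureReal]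
  rw [← h, ← (measurePreserving_prodAssoc τ ν X).measure_preimage_equiv]
  rfl

lemma lintegral_pass {a : ℝ} (h0 : 0 ≤ a) (h1 : a ≤ 1) (ν₁ ν₂ X : Measure ℝ≥0)
    [IsProbabilityMeasure ν₁] [IsProbabilityMeasure ν₂] [IsProbabilityMeasure X] (u : ℝ) :
    ∫⁻ w, pass u w ∂((twoPhase a ν₁ ν₂).prod X) =
      1 - (volume (Set.Iic u ∩ Set.Icc 0 a) * ENNReal.ofReal (acceptProb ν₁ X) +
        volume (Set.Iic u ∩ Set.Ioc a 1) * ENNReal.ofReal (acceptProb ν₂ X)) := by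
  have := isProbabilityMeasure_twoPhase h0 h1 ν₁ ν₂
  set S : Set ((ℝ × ℝ≥0) × ℝ≥0) := {z | z.1.1 ≤ u ∧ z.1.2 ≤ z.2} with hS
  have hSm : MeasurableSet S :=
    (measurableSet_le (f := fun z : (ℝ × ℝ≥0) × ℝ≥0 => z.1.1) (g := fun _ => u) (by fun_prop)
      (by fun_prop)).inter (measurableSet_le (f := fun z : (ℝ × ℝ≥0) × ℝ≥0 => z.1.2)
        (g := fun z => z.2) (by fun_prop) (by fun_prop))
  have hpass : pass u = Sᶜ.indicator 1 := by
    ext z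
    by_cases h : z ∈ S
    · rw [Set.indicator_of_notMem (by simpa using h)]; exact if_pos h
    · rw [Set.indicator_of_mem (by simpa using h)]; exact if_neg h
  rw [hpass, lintegral_indicator_one hSm.compl, prob_compl_eq_one_sub hSm, twoPhase,
    Measure.add_prod, Measure.add_apply, measure_accept_prod, measure_accept_prod,
    Measure.restrict_apply measurableSet_Iic, Measure.restrict_apply measurableSet_Iic]

lemma lintegral_pass_of_mem_Icc {a : ℝ} (h1 : a ≤ 1) (ν₁ ν₂ X : Measure ℝ≥0)
    [IsProbabilityMeasure ν₁] [IsProbabilityMeasure ν₂] [IsProbabilityMeasure X] {u : ℝ}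
    (hu : u ∈ Set.Icc 0 a) :
    ∫⁻ w, pass u w ∂((twoPhase a ν₁ ν₂).prod X) = ENNReal.ofReal (1 - u * acceptProb ν₁ X) := by
  have e1 : Set.Iic u ∩ Set.Icc 0 a = Set.Icc 0 u := by
    ext t; simp only [Set.mem_inter_iff, Set.mem_Iic, Set.mem_Icc] at *; grind
  have e2 : Set.Iic u ∩ Set.Ioc a 1 = ∅ := by
    ext t; simp only [Set.mem_inter_iff, Set.mem_Iic, Set.mem_Ioc, Set.mem_Icc] at *; grind
  rw [lintegral_pass (hu.1.trans hu.2) h1, e1, e2]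
  rw [Real.volume_Icc, sub_zero, measure_empty, zero_mul, add_zero, ← ENNReal.ofReal_mul hu.1,
    ENNReal.ofReal_sub _ (mul_nonneg hu.1 (acceptProb_nonneg _ _)), ENNReal.ofReal_one]

lemma lintegral_pass_of_mem_Ioc {a : ℝ} (h0 : 0 ≤ a) (ν₁ ν₂ X : Measure ℝ≥0)
    [IsProbabilityMeasure ν₁] [IsProbabilityMeasure ν₂] [IsProbabilityMeasure X] {u : ℝ}
    (hu : u ∈ Set.Ioc a 1) :
    ∫⁻ w, pass u w ∂((twoPhase a ν₁ ν₂).prod X) =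
      ENNReal.ofReal (1 - a * acceptProb ν₁ X - (u - a) * acceptProb ν₂ X) := by
  have e1 : Set.Iic u ∩ Set.Icc 0 a = Set.Icc 0 a := by
    ext t; simp only [Set.mem_inter_iff, Set.mem_Iic, Set.mem_Icc, Set.mem_Ioc] at *; grind
  have e2 : Set.Iic u ∩ Set.Ioc a 1 = Set.Ioc a u := by
    ext t; simp only [Set.mem_inter_iff, Set.mem_Iic, Set.mem_Ioc] at *; grind
  have hp := mul_nonneg h0 (acceptProb_nonneg ν₁ X)
  have hr := mul_nonneg (sub_nonneg.2 hu.1.le) (acceptProb_nonneg ν₂ X)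
  rw [lintegral_pass h0 (hu.1.le.trans hu.2), e1, e2, Real.volume_Icc, Real.volume_Ioc, sub_zero,
    ← ENNReal.ofReal_mul h0, ← ENNReal.ofReal_mul (sub_nonneg.2 hu.1.le),
    ← ENNReal.ofReal_add hp hr, sub_sub, ENNReal.ofReal_sub _ (add_nonneg hp hr),
    ENNReal.ofReal_one]

/-! ### Inequalities and identities for survival products -/

section Products

variable {ι : Type*}

/-- Chebyshev's correlation inequality. Let a state be 0, p or r with probabilities 1 - a - b, a and
b. On the left each factor draws its own state, on the right all factors share one. Since 0 ≤ p ≤ r,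
the factors 1, 1 - p j, 1 - r j decrease together, so sharing the state can only raise the mean of
the product. -/
lemma prod_affine_le_affine_prod (s : Finset ι) {a b : ℝ} (ha : 0 ≤ a) (hb : 0 ≤ b)
    (hab : a + b ≤ 1) {p r : ι → ℝ} (hp : ∀ j, 0 ≤ p j) (hpr : ∀ j, p j ≤ r j)
    (hr : ∀ j, r j ≤ 1) :
    ∏ j ∈ s, (1 - a * p j - b * r j) ≤
      1 - a - b + a * ∏ j ∈ s, (1 - p j) + b * ∏ j ∈ s, (1 - r j) := by
  classical
  induction s using Finset.induction_on with
  | empty => simp only [Finset.prod_empty]; linarith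
  | insert i s hi ih =>
    rw [Finset.prod_insert hi, Finset.prod_insert hi, Finset.prod_insert hi]
    set A := ∏ j ∈ s, (1 - p j)
    set B := ∏ j ∈ s, (1 - r j)
    have hA : A ≤ 1 := Finset.prod_le_one (fun j _ => by linarith [hpr j, hr j])
      fun j _ => by linarith [hp j]
    have hBA : B ≤ A := Finset.prod_le_prod (fun j _ => by linarith [hr j])
      fun j _ => by linarith [hpr j]
    have h0 := hp i
    have h1 := hpr i
    have h2 := hr i
    have hfac : 0 ≤ 1 - a * p i - b * r i := by nlinarith
    refine (mul_le_mul_of_nonneg_left ih hfac).trans ?_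
    -- One nonnegative covariance term for each pair of states: (0, p), (0, r) and (p, r).
    have k1 := mul_nonneg (mul_nonneg (sub_nonneg.2 hab) ha) (mul_nonneg h0 (sub_nonneg.2 hA))
    have k2 := mul_nonneg (mul_nonneg (sub_nonneg.2 hab) hb)
      (mul_nonneg (h0.trans h1) (sub_nonneg.2 (hBA.trans hA)))
    have k3 := mul_nonneg (mul_nonneg ha hb) (mul_nonneg (sub_nonneg.2 h1) (sub_nonneg.2 hBA))
    nlinarith

/-- Weighted AM-GM applied to 1 - p j, 1 - r j and 1 in each factor. The missing factor i is at most
1, so including it on the left gives a bound independent of i. -/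
lemma rpow_prod_mul_rpow_prod_le [Fintype ι] [DecidableEq ι] (i : ι) {a b : ℝ} (ha : 0 ≤ a)
    (hb : 0 ≤ b) (hab : a + b ≤ 1) {p r : ι → ℝ} (hp : ∀ j, 0 ≤ p j) (hp1 : ∀ j, p j ≤ 1)
    (hr : ∀ j, 0 ≤ r j) (hr1 : ∀ j, r j ≤ 1) :
    (∏ j, (1 - p j)) ^ a * (∏ j, (1 - r j)) ^ b ≤
      ∏ j ∈ Finset.univ.erase i, (1 - a * p j - b * r j) := by
  have key (j : ι) : (1 - p j) ^ a * (1 - r j) ^ b ≤ 1 - a * p j - b * r j := by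
    have := Real.geom_mean_le_arith_mean3_weighted ha hb (w₃ := 1 - a - b) (by linarith)
      (sub_nonneg.2 (hp1 j)) (sub_nonneg.2 (hr1 j)) zero_le_one (by ring)
    rw [Real.one_rpow, mul_one] at this
    linarith
  have hnn (j : ι) : 0 ≤ (1 - p j) ^ a * (1 - r j) ^ b :=
    mul_nonneg (Real.rpow_nonneg (sub_nonneg.2 (hp1 j)) _)
      (Real.rpow_nonneg (sub_nonneg.2 (hr1 j)) _)
  rw [← Real.finsetProd_rpow _ _ fun j _ => sub_nonneg.2 (hp1 j),
    ← Real.finsetProd_rpow _ _ fun j _ => sub_nonneg.2 (hr1 j), ← Finset.prod_mul_distrib,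
    ← Finset.mul_prod_erase _ _ (Finset.mem_univ i)]
  refine (mul_le_of_le_one_left (Finset.prod_nonneg fun j _ => hnn j) ?_).trans
    (Finset.prod_le_prod (fun j _ => hnn j) fun j _ => key j)
  refine (key i).trans ?_
  nlinarith [hp i, hr i, mul_nonneg ha (hp i), mul_nonneg hb (hr i)]

/-- The sum of integrands is minus the derivative of the full product. In probabilistic terms,
stopping between times s and t is split according to the sample that causes it. -/
lemma sum_mul_integral_prod_erase [Fintype ι] [DecidableEq ι] (c d : ι → ℝ) (s t : ℝ) :
    ∑ i, d i * ∫ u in s..t, ∏ j ∈ Finset.univ.erase i, (c j - (u - s) * d j) =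
      ∏ j, c j - ∏ j, (c j - (t - s) * d j) := by
  have hd (u : ℝ) : HasDerivAt (fun u => ∏ j, (c j - (u - s) * d j))
      (-∑ i, d i * ∏ j ∈ Finset.univ.erase i, (c j - (u - s) * d j)) u := by
    have h1 (j : ι) : HasDerivAt (fun u => c j - (u - s) * d j) (-d j) u := by
      simpa using (((hasDerivAt_id u).sub_const s).mul_const (d j)).const_sub (c j)
    refine (HasDerivAt.fun_finsetProd (u := Finset.univ) fun j _ => h1 j).congr_deriv ?_
    rw [← Finset.sum_neg_distrib]
    refine Finset.sum_congr rfl fun i _ => ?_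
    simp only [smul_eq_mul]; ring
  have hc (i : ι) : Continuous fun u : ℝ =>
      ∏ j ∈ Finset.univ.erase i, (c j - (u - s) * d j) := by fun_prop
  have h := intervalIntegral.integral_eq_sub_of_hasDerivAt (a := s) (b := t) (fun u _ => hd u)
    (Continuous.intervalIntegrable (by fun_prop) _ _)
  rw [intervalIntegral.integral_neg, intervalIntegral.integral_finsetSum
    fun i _ => ((hc i).const_mul (d i)).intervalIntegrable _ _] at h
  simp only [intervalIntegral.integral_const_mul, sub_self, zero_mul, sub_zero] at h
  linarith

lemma integral_exp_neg_mul {L : ℝ} (hL : L ≠ 0) (s t : ℝ) :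
    ∫ u in s..t, Real.exp (-(L * (u - s))) = (1 - Real.exp (-(L * (t - s)))) / L := by
  have h (u : ℝ) : HasDerivAt (fun u => -(Real.exp (-(L * (u - s))) / L))
      (Real.exp (-(L * (u - s)))) u := by
    have := ((((hasDerivAt_id u).sub_const s).const_mul L).neg.exp.div_const L).neg
    refine this.congr_deriv ?_
    simp only [id_eq, mul_one]
    field_simp
    rfl
  rw [intervalIntegral.integral_eq_sub_of_hasDerivAt (fun u _ => h u)
    (Continuous.intervalIntegrable (by fun_prop) _ _)]
  simp
  ring

end Products

/-! ### Randomized thresholds with prescribed rejection probability -/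

/-- Interpolating between consecutive grid points makes the product continuous; it runs from 0 at k
= 0 towards 1, so the intermediate value theorem applies. -/
lemma exists_prod_mix_eq {ι : Type*} [Fintype ι] [Nonempty ι] {t : ι → ℕ → ℝ}
    (ht0 : ∀ j, t j 0 = 1) (ht : ∀ j, Filter.Tendsto (t j) Filter.atTop (nhds 0)) {P : ℝ}
    (hP0 : 0 < P) (hP1 : P < 1) :
    ∃ k : ℕ, ∃ b ∈ Set.Icc (0 : ℝ) 1, ∏ j, (1 - (b * t j k + (1 - b) * t j (k + 1))) = P := by
  classical
  have hlim : Filter.Tendsto (fun k => ∏ j, (1 - t j k)) Filter.atTop (nhds 1) := by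
    have := tendsto_finsetProd Finset.univ fun j _ => (ht j).const_sub 1
    simpa using this
  have hex : ∃ k, P < ∏ j, (1 - t j k) := (hlim.eventually (lt_mem_nhds hP1)).exists
  -- The first index exceeding P is not 0, because there every factor is 0 and `ι` is nonempty.
  obtain ⟨k, hk⟩ : ∃ k, Nat.find hex = k + 1 := by
    refine Nat.exists_eq_succ_of_ne_zero fun h => ?_
    have := Nat.find_spec hex
    rw [h] at this
    simp [ht0] at this
    linarith
  refine ⟨k, ?_⟩
  have hlow : ∏ j, (1 - t j k) ≤ P := not_lt.1 (Nat.find_min hex (by omega))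
  have hhigh : P < ∏ j, (1 - t j (k + 1)) := hk ▸ Nat.find_spec hex
  have hcont : ContinuousOn (fun b : ℝ => ∏ j, (1 - (b * t j k + (1 - b) * t j (k + 1))))
      (Set.Icc 0 1) := by fun_prop
  refine intermediate_value_Icc' zero_le_one hcont ⟨?_, ?_⟩
  · simpa using hlow
  · simpa using hhigh.le

/-- All mixtures lie on one path along which every coordinate decreases, so comparing the products
decides which comes first. This supplies both v₂ ≤ v₁ and the ordering p ≤ r that the correlation
inequality requires. -/
lemma mix_le_mix_of_prod_lt {ι : Type*} [Fintype ι] {t : ι → ℕ → ℝ} (ht : ∀ j, Antitone (t j))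
    (ht1 : ∀ j k, t j k ≤ 1) {k₁ k₂ : ℕ} {b₁ b₂ : ℝ}
    (hb₁ : b₁ ∈ Set.Icc (0 : ℝ) 1) (hb₂ : b₂ ∈ Set.Icc (0 : ℝ) 1)
    (h : ∏ j, (1 - (b₂ * t j k₂ + (1 - b₂) * t j (k₂ + 1))) <
      ∏ j, (1 - (b₁ * t j k₁ + (1 - b₁) * t j (k₁ + 1)))) :
    k₂ ≤ k₁ ∧ ∀ j, b₁ * t j k₁ + (1 - b₁) * t j (k₁ + 1) ≤ b₂ * t j k₂ + (1 - b₂) * t j (k₂ + 1) := by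
  obtain ⟨h10, h11⟩ := hb₁
  obtain ⟨h20, h21⟩ := hb₂
  have hstep (j : ι) (k : ℕ) : t j (k + 1) ≤ t j k := ht j k.le_succ
  have hle {b : ℝ} (h0 : 0 ≤ b) (h1 : b ≤ 1) (j : ι) (k : ℕ) :
      b * t j k + (1 - b) * t j (k + 1) ≤ t j k := by nlinarith [hstep j k]
  have hge {b : ℝ} (h0 : 0 ≤ b) (h1 : b ≤ 1) (j : ι) (k : ℕ) :
      t j (k + 1) ≤ b * t j k + (1 - b) * t j (k + 1) := by nlinarith [hstep j k]
  have hcon (hc : ∀ j, b₂ * t j k₂ + (1 - b₂) * t j (k₂ + 1) ≤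
      b₁ * t j k₁ + (1 - b₁) * t j (k₁ + 1)) : False := by
    refine h.not_ge (Finset.prod_le_prod (fun j _ => ?_) fun j _ => by linarith [hc j])
    linarith [hle h10 h11 j k₁, ht1 j k₁]
  rcases lt_trichotomy k₁ k₂ with hk | rfl | hk
  · exact (hcon fun j => ((hle h20 h21 j k₂).trans (ht j hk)).trans (hge h10 h11 j k₁)).elim
  · refine ⟨le_rfl, fun j => ?_⟩
    rcases le_total b₁ b₂ with hb | hb
    · nlinarith [hstep j k₁]
    · exact (hcon fun j => by nlinarith [hstep j k₁]).elim
  · exact ⟨hk.le, fun j => ((hle h10 h11 j k₁).trans (ht j hk)).trans (hge h20 h21 j k₂)⟩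

/-- The threshold `k ε` with probability `b`, and `(k + 1) ε` otherwise. -/
noncomputable def gridLaw (ε : ℝ≥0) (k : ℕ) (b : ℝ) : Measure ℝ≥0 :=
  ENNReal.ofReal b • Measure.dirac (k * ε) + ENNReal.ofReal (1 - b) • Measure.dirac ((k + 1 : ℕ) * ε)

lemma isProbabilityMeasure_gridLaw (ε : ℝ≥0) (k : ℕ) {b : ℝ} (hb : b ∈ Set.Icc (0 : ℝ) 1) :
    IsProbabilityMeasure (gridLaw ε k b) := by
  constructor
  rw [gridLaw, Measure.add_apply, Measure.smul_apply, Measure.smul_apply, measure_univ,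
    measure_univ, smul_eq_mul, smul_eq_mul, mul_one, mul_one,
    ← ENNReal.ofReal_add hb.1 (sub_nonneg.2 hb.2)]
  simp

lemma ae_gridLaw (ε : ℝ≥0) (k : ℕ) (b : ℝ) :
    ∀ᵐ θ ∂(gridLaw ε k b), θ ∈ Set.Icc (k * ε) (k * ε + ε) := by
  rw [gridLaw, ae_add_measure_iff]
  constructor
  · refine Measure.ae_smul_measure ((ae_dirac_iff measurableSet_Icc).2 ?_) _
    exact ⟨le_rfl, le_self_add⟩
  · refine Measure.ae_smul_measure ((ae_dirac_iff measurableSet_Icc).2 ?_) _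
    push_cast
    rw [add_mul, one_mul]
    exact ⟨le_self_add, le_rfl⟩

lemma acceptProb_gridLaw (ε : ℝ≥0) (k : ℕ) {b : ℝ} (hb : b ∈ Set.Icc (0 : ℝ) 1)
    (X : Measure ℝ≥0) [IsProbabilityMeasure X] :
    acceptProb (gridLaw ε k b) X =
      b * X.real (Set.Ici (k * ε)) + (1 - b) * X.real (Set.Ici ((k + 1 : ℕ) * ε)) := by
  have hS : MeasurableSet {y : ℝ≥0 × ℝ≥0 | y.1 ≤ y.2} :=
    measurableSet_le (by fun_prop) (by fun_prop)
  have := isProbabilityMeasure_gridLaw ε k hb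
  rw [acceptProb, measureReal_def, Measure.prod_apply hS, gridLaw, lintegral_add_measure,
    lintegral_smul_measure, lintegral_smul_measure, lintegral_dirac, lintegral_dirac, smul_eq_mul,
    smul_eq_mul, ENNReal.toReal_add (by finiteness) (by finiteness)]
  simp only [ENNReal.toReal_mul, ENNReal.toReal_ofReal hb.1,
    ENNReal.toReal_ofReal (sub_nonneg.2 hb.2)]
  rfl

/-- Nearly deterministic random thresholds that turn all samples down with given probabilities. -/
lemma exists_thresholdLaws {n : ℕ} [NeZero n] (X : Instance n) {ε : ℝ≥0} (hε : 0 < ε) {P₁ P₂ : ℝ}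
    (hP₂ : 0 < P₂) (hP : P₂ < P₁) (hP₁ : P₁ < 1) :
    ∃ v₁ v₂ : ℝ≥0, ∃ ν₁ ν₂ : Measure ℝ≥0, IsProbabilityMeasure ν₁ ∧ IsProbabilityMeasure ν₂ ∧
      (∀ᵐ θ ∂ν₁, θ ∈ Set.Icc v₁ (v₁ + ε)) ∧ (∀ᵐ θ ∂ν₂, θ ∈ Set.Icc v₂ (v₂ + ε)) ∧ v₂ ≤ v₁ ∧
      ∏ j, (1 - acceptProb ν₁ (X j)) = P₁ ∧ ∏ j, (1 - acceptProb ν₂ (X j)) = P₂ ∧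
      ∀ j, acceptProb ν₁ (X j) ≤ acceptProb ν₂ (X j) := by
  set t : Fin n → ℕ → ℝ := fun j k => (X j : Measure ℝ≥0).real (Set.Ici (k * ε)) with htdef
  have hmono : Monotone fun k : ℕ => (k : ℝ≥0) * ε := fun k l hkl => by dsimp only; gcongr
  have ht (j : Fin n) : Antitone (t j) := fun k l hkl =>
    measureReal_mono (Set.Ici_subset_Ici.2 (hmono hkl))
  have ht1 (j : Fin n) (k : ℕ) : t j k ≤ 1 := measureReal_le_one
  have ht0 (j : Fin n) : t j 0 = 1 := by
    have : Set.Ici (0 : ℝ≥0) = Set.univ := by ext; simp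
    simp [htdef, this]
  have htlim (j : Fin n) : Filter.Tendsto (t j) Filter.atTop (nhds 0) := by
    have h := tendsto_measure_iInter_atTop (μ := (X j : Measure ℝ≥0))
      (s := fun k : ℕ => Set.Ici ((k : ℝ≥0) * ε)) (fun k => measurableSet_Ici.nullMeasurableSet)
      (fun k l hkl => Set.Ici_subset_Ici.2 (hmono hkl)) ⟨0, measure_ne_top _ _⟩
    have hempty : ⋂ k : ℕ, Set.Ici ((k : ℝ≥0) * ε) = ∅ := by
      ext y
      simp only [Set.mem_iInter, Set.mem_Ici, Set.mem_empty_iff_false, iff_false, not_forall, not_le]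
      obtain ⟨k, hk⟩ := exists_nat_gt (y / ε)
      exact ⟨k, (div_lt_iff₀ hε).1 hk⟩
    rw [hempty, measure_empty] at h
    exact (ENNReal.tendsto_toReal ENNReal.zero_ne_top).comp h
  obtain ⟨k₁, b₁, hb₁, h₁⟩ := exists_prod_mix_eq ht0 htlim (hP₂.trans hP) hP₁
  obtain ⟨k₂, b₂, hb₂, h₂⟩ := exists_prod_mix_eq ht0 htlim hP₂ (hP.trans hP₁)
  obtain ⟨hk, hle⟩ := mix_le_mix_of_prod_lt ht ht1 hb₁ hb₂ (by rw [h₁, h₂]; exact hP)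
  refine ⟨k₁ * ε, k₂ * ε, gridLaw ε k₁ b₁, gridLaw ε k₂ b₂, isProbabilityMeasure_gridLaw ε k₁ hb₁,
    isProbabilityMeasure_gridLaw ε k₂ hb₂, ae_gridLaw ε k₁ b₁, ae_gridLaw ε k₂ b₂, hmono hk,
    ?_, ?_, ?_⟩
  · simp_rw [acceptProb_gridLaw ε k₁ hb₁]; exact h₁
  · simp_rw [acceptProb_gridLaw ε k₂ hb₂]; exact h₂
  · simp_rw [acceptProb_gridLaw ε k₁ hb₁, acceptProb_gridLaw ε k₂ hb₂]; exact hle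

/-! ### Value and probability of acceptance -/

section Accepted

variable {ν X : Measure ℝ≥0} [IsProbabilityMeasure ν] [IsProbabilityMeasure X] {v m : ℝ≥0}

/-- With the threshold in [v, m], an accepted x is at least v and hence at least v + (x - m)⁺, while
a rejected x lies below m and has no excess. -/
lemma le_acceptedValue (hν : ∀ᵐ θ ∂ν, θ ∈ Set.Icc v m) :
    v * ENNReal.ofReal (acceptProb ν X) + ∫⁻ x, ((x - m : ℝ≥0) : ℝ≥0∞) ∂X ≤ acceptedValue ν X := by
  have hS : MeasurableSet {y : ℝ≥0 × ℝ≥0 | y.1 ≤ y.2} :=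
    measurableSet_le (by fun_prop) (by fun_prop)
  have h1 : v * ENNReal.ofReal (acceptProb ν X) =
      ∫⁻ y, v * {y : ℝ≥0 × ℝ≥0 | y.1 ≤ y.2}.indicator 1 y ∂(ν.prod X) := by
    rw [lintegral_const_mul _ (measurable_one.indicator hS), lintegral_indicator_one hS, acceptProb,
      ofReal_measureReal]
  have h2 : ∫⁻ x, ((x - m : ℝ≥0) : ℝ≥0∞) ∂X = ∫⁻ y, ((y.2 - m : ℝ≥0) : ℝ≥0∞) ∂(ν.prod X) :=
    (measurePreserving_snd.lintegral_comp (f := fun x : ℝ≥0 => ((x - m : ℝ≥0) : ℝ≥0∞))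
      (by fun_prop)).symm
  rw [h1, h2, ← lintegral_add_right _ (by fun_prop), acceptedValue]
  refine lintegral_mono_ae ?_
  filter_upwards [Measure.quasiMeasurePreserving_fst.ae hν] with y hy
  by_cases h : y.1 ≤ y.2
  · simp only [Set.indicator, Set.mem_ofPred_eq, h, if_true, Pi.one_apply, mul_one]
    norm_cast
    rcases le_total y.2 m with hm | hm
    · rw [tsub_eq_zero_of_le hm, add_zero]; exact hy.1.trans h
    · calc v + (y.2 - m) ≤ m + (y.2 - m) := by gcongr; exact hy.1.trans hy.2
        _ = y.2 := add_tsub_cancel_of_le hm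
  · have : y.2 ≤ m := (not_le.1 h).le.trans hy.2
    simp [h, tsub_eq_zero_of_le this]

lemma measureReal_Ioi_le_acceptProb (hν : ∀ᵐ θ ∂ν, θ ∈ Set.Icc v m) :
    X.real (Set.Ioi m) ≤ acceptProb ν X := by
  have h : (ν.prod X).real (Set.Icc v m ×ˢ Set.Ioi m) = X.real (Set.Ioi m) := by
    rw [measureReal_prod_prod, measureReal_def ν, (prob_compl_eq_zero_iff measurableSet_Icc).1 hν]
    simp
  rw [← h]
  exact measureReal_mono fun y hy => hy.1.2.trans (le_of_lt hy.2)

end Accepted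

/-! ### The expected maximum and its excess over a level -/

section Benchmark

variable {n : ℕ} (X : Instance n)

/-- The expected excess of the maximum over `m`. -/
noncomputable def Instance.excess (m : ℝ≥0) : ℝ≥0∞ :=
  ∫⁻ x, ((Finset.univ.sup x - m : ℝ≥0) : ℝ≥0∞) ∂X.law

lemma measurable_sup : Measurable fun x : Fin n → ℝ≥0 => Finset.univ.sup x :=
  (Continuous.finset_sup_apply (f := fun (i : Fin n) (x : Fin n → ℝ≥0) => x i)
    fun i _ => continuous_apply i).measurable

lemma benchmark_le (m : ℝ≥0) : X.benchmark ≤ m + X.excess m := by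
  calc X.benchmark ≤ ∫⁻ x, ((m : ℝ≥0∞) + ((Finset.univ.sup x - m : ℝ≥0) : ℝ≥0∞)) ∂X.law :=
        lintegral_mono fun x => by
          rw [← ENNReal.coe_add]; exact ENNReal.coe_le_coe.2 le_add_tsub
    _ = _ := by rw [lintegral_add_left measurable_const]; simp [Instance.excess]

lemma excess_le_benchmark (m : ℝ≥0) : X.excess m ≤ X.benchmark :=
  lintegral_mono fun _ => ENNReal.coe_le_coe.2 tsub_le_self

lemma lintegral_eval {i : Fin n} {f : ℝ≥0 → ℝ≥0∞} (hf : Measurable f) :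
    ∫⁻ x, f (x i) ∂X.law = ∫⁻ y, f y ∂(X i : Measure ℝ≥0) :=
  (measurePreserving_eval (fun j => (X j : Measure ℝ≥0)) i).lintegral_comp hf

lemma lintegral_tsub_le_excess (m : ℝ≥0) (i : Fin n) :
    ∫⁻ y, ((y - m : ℝ≥0) : ℝ≥0∞) ∂(X i : Measure ℝ≥0) ≤ X.excess m := by
  rw [← lintegral_eval X (f := fun y => ((y - m : ℝ≥0) : ℝ≥0∞)) (by fun_prop)]
  exact lintegral_mono fun x => ENNReal.coe_le_coe.2
    (tsub_le_tsub_right (Finset.le_sup (f := x) (Finset.mem_univ i)) m)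

lemma excess_le_sum (m : ℝ≥0) :
    X.excess m ≤ ∑ i, ∫⁻ y, ((y - m : ℝ≥0) : ℝ≥0∞) ∂(X i : Measure ℝ≥0) := by
  simp_rw [← fun i => lintegral_eval X (i := i) (f := fun y => ((y - m : ℝ≥0) : ℝ≥0∞))
    (by fun_prop)]
  rw [← lintegral_finsetSum _ (fun i _ => by fun_prop)]
  refine lintegral_mono fun x => ?_
  rw [← ENNReal.ofNNReal_finsetSum]
  refine ENNReal.coe_le_coe.2 ?_
  rw [tsub_le_iff_right]
  refine Finset.sup_le fun i hi => ?_
  rw [← tsub_le_iff_right]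
  exact Finset.single_le_sum (f := fun i => x i - m) (fun _ _ => zero_le) hi

/-- Lowering the level from m₁ to m₂ adds at most m₁ - m₂, and only when the maximum exceeds m₂, an
event of probability at most 1 - P. -/
lemma excess_le_excess_add {m₁ m₂ : ℝ≥0} {P : ℝ}
    (hP : P ≤ ∏ j, (1 - (X j : Measure ℝ≥0).real (Set.Ioi m₂))) :
    X.excess m₂ ≤ X.excess m₁ + (m₁ - m₂ : ℝ≥0) * ENNReal.ofReal (1 - P) := by
  set S : Set (Fin n → ℝ≥0) := {x | m₂ < Finset.univ.sup x} with hSdef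
  have hS : MeasurableSet S := measurableSet_lt measurable_const measurable_sup
  have hc : Sᶜ = Set.pi Set.univ fun _ => Set.Iic m₂ := by
    ext x; simp [hSdef, Pi.le_def]
  have hreal : X.law.real Sᶜ = ∏ j, (1 - (X j : Measure ℝ≥0).real (Set.Ioi m₂)) := by
    rw [hc, measureReal_def, Instance.law, Measure.pi_pi, ENNReal.toReal_prod]
    refine Finset.prod_congr rfl fun j _ => ?_
    rw [← Set.compl_Ioi, ← measureReal_def, probReal_compl_eq_one_sub measurableSet_Ioi]
  have hle : X.law S ≤ ENNReal.ofReal (1 - P) := by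
    rw [← ofReal_measureReal (μ := X.law) (s := S)]
    have := probReal_add_probReal_compl (μ := X.law) hS
    exact ENNReal.ofReal_le_ofReal (by linarith)
  calc X.excess m₂ ≤ ∫⁻ x, (((Finset.univ.sup x - m₁ : ℝ≥0) : ℝ≥0∞) +
        (m₁ - m₂ : ℝ≥0) * S.indicator 1 x) ∂X.law := lintegral_mono fun x => ?_
    _ = X.excess m₁ + (m₁ - m₂ : ℝ≥0) * X.law S := by
      rw [lintegral_add_right _ ((measurable_one.indicator hS).const_mul _),
        lintegral_const_mul _ (measurable_one.indicator hS), lintegral_indicator_one hS,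
        Instance.excess]
    _ ≤ _ := by gcongr
  by_cases h : x ∈ S
  · simp only [Set.indicator_of_mem h, Pi.one_apply, mul_one]
    norm_cast
    exact tsub_le_tsub_add_tsub
  · have : Finset.univ.sup x ≤ m₂ := not_lt.1 h
    simp [tsub_eq_zero_of_le this]

end Benchmark

/-! ### The two-phase guarantee -/

/-- The expected profit when samples carry independent two-phase marks. -/
lemma lintegral_markedProfit_twoPhase {n : ℕ} (X : Instance n) {a : ℝ} (h0 : 0 ≤ a) (h1 : a ≤ 1)
    (ν₁ ν₂ : Measure ℝ≥0) [IsProbabilityMeasure ν₁] [IsProbabilityMeasure ν₂] :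
    ∫⁻ s, ∫⁻ x, markedProfit (fun i => (s i, x i)) ∂X.law
        ∂(Measure.pi fun _ => twoPhase a ν₁ ν₂) =
      ∑ i, (acceptedValue ν₁ (X i) * ENNReal.ofReal (∫ u in (0 : ℝ)..a,
          ∏ j ∈ Finset.univ.erase i, (1 - u * acceptProb ν₁ (X j))) +
        acceptedValue ν₂ (X i) * ENNReal.ofReal (∫ u in a..1, ∏ j ∈ Finset.univ.erase i,
          (1 - a * acceptProb ν₁ (X j) - (u - a) * acceptProb ν₂ (X j)))) := by
  have := isProbabilityMeasure_twoPhase h0 h1 ν₁ ν₂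
  rw [lintegral_markedProfit]
  refine Finset.sum_congr rfl fun i _ => ?_
  have hF : Measurable fun u => ∏ j ∈ Finset.univ.erase i,
      ∫⁻ w, pass u w ∂((twoPhase a ν₁ ν₂).prod (X j)) :=
    Finset.measurable_prod _ fun j _ => measurable_pass.lintegral_prod_right'
  rw [lintegral_gain_mul_twoPhase a ν₁ ν₂ (X i) hF]
  have hp (j : Fin n) := acceptProb_nonneg ν₁ (X j)
  have hp1 (j : Fin n) := acceptProb_le_one ν₁ (X j)
  have hr (j : Fin n) := acceptProb_nonneg ν₂ (X j)
  have hr1 (j : Fin n) := acceptProb_le_one ν₂ (X j)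
  have hpos₁ {u : ℝ} (hu : u ∈ Set.Icc 0 a) (j : Fin n) : 0 ≤ 1 - u * acceptProb ν₁ (X j) := by
    nlinarith [hp j, hp1 j, hu.1, hu.2]
  have hpos₂ {u : ℝ} (hu : u ∈ Set.Ioc a 1) (j : Fin n) :
      0 ≤ 1 - a * acceptProb ν₁ (X j) - (u - a) * acceptProb ν₂ (X j) := by
    nlinarith [hp j, hp1 j, hr j, hr1 j, hu.1, hu.2]
  congr 2
  · rw [intervalIntegral.integral_of_le h0, ← integral_Icc_eq_integral_Ioc,
      ofReal_integral_eq_lintegral_ofReal]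
    · refine setLIntegral_congr_fun measurableSet_Icc fun u hu => ?_
      rw [ENNReal.ofReal_prod_of_nonneg fun j _ => hpos₁ hu j]
      exact Finset.prod_congr rfl fun j _ => lintegral_pass_of_mem_Icc h1 ν₁ ν₂ (X j) hu
    · exact Continuous.integrableOn_Icc (by fun_prop)
    · filter_upwards [ae_restrict_mem measurableSet_Icc] with u hu
      exact Finset.prod_nonneg fun j _ => hpos₁ hu j
  · rw [intervalIntegral.integral_of_le h1, ofReal_integral_eq_lintegral_ofReal]
    · refine setLIntegral_congr_fun measurableSet_Ioc fun u hu => ?_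
      rw [ENNReal.ofReal_prod_of_nonneg fun j _ => hpos₂ hu j]
      exact Finset.prod_congr rfl fun j _ => lintegral_pass_of_mem_Ioc h0 ν₁ ν₂ (X j) hu
    · exact Continuous.integrableOn_Ioc (by fun_prop)
    · filter_upwards [ae_restrict_mem measurableSet_Ioc] with u hu
      exact Finset.prod_nonneg fun j _ => hpos₂ hu j

section Phases

variable {ι : Type*} [Fintype ι] [DecidableEq ι] {p r : ι → ℝ} {a L₁ L₂ : ℝ}

lemma le_integral_first_phase (i : ι) (h0 : 0 ≤ a) (h1 : a ≤ 1) (hL : L₁ ≠ 0) (hp : ∀ j, 0 ≤ p j)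
    (hp1 : ∀ j, p j ≤ 1) (hP : ∏ j, (1 - p j) = Real.exp (-L₁)) :
    (1 - Real.exp (-(L₁ * a))) / L₁ ≤
      ∫ u in (0 : ℝ)..a, ∏ j ∈ Finset.univ.erase i, (1 - u * p j) := by
  have h := integral_exp_neg_mul hL 0 a
  rw [sub_zero] at h
  rw [← h]
  refine intervalIntegral.integral_mono_on h0 (Continuous.intervalIntegrable (by fun_prop) _ _)
    (Continuous.intervalIntegrable (by fun_prop) _ _) fun u hu => ?_
  have := rpow_prod_mul_rpow_prod_le i hu.1 le_rfl (by linarith [hu.2]) hp hp1 hp hp1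
  rw [Real.rpow_zero, mul_one, hP, ← Real.exp_mul] at this
  simp only [zero_mul, sub_zero] at this ⊢
  convert this using 2
  ring

lemma le_integral_second_phase (i : ι) (h0 : 0 ≤ a) (h1 : a ≤ 1) (hL : L₂ ≠ 0)
    (hp : ∀ j, 0 ≤ p j) (hp1 : ∀ j, p j ≤ 1) (hr : ∀ j, 0 ≤ r j) (hr1 : ∀ j, r j ≤ 1)
    (hP : ∏ j, (1 - p j) = Real.exp (-L₁)) (hR : ∏ j, (1 - r j) = Real.exp (-L₂)) :
    Real.exp (-(L₁ * a)) * ((1 - Real.exp (-(L₂ * (1 - a)))) / L₂) ≤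
      ∫ u in a..1, ∏ j ∈ Finset.univ.erase i, (1 - a * p j - (u - a) * r j) := by
  rw [← integral_exp_neg_mul hL a 1, ← intervalIntegral.integral_const_mul]
  refine intervalIntegral.integral_mono_on h1 (Continuous.intervalIntegrable (by fun_prop) _ _)
    (Continuous.intervalIntegrable (by fun_prop) _ _) fun u hu => ?_
  have := rpow_prod_mul_rpow_prod_le i h0 (sub_nonneg.2 hu.1) (by linarith [hu.2]) hp hp1 hr hr1
  rw [hP, hR, ← Real.exp_mul, ← Real.exp_mul, neg_mul, neg_mul] at this
  exact this

lemma le_sum_first_phase (h0 : 0 ≤ a) (h1 : a ≤ 1) (hp : ∀ j, 0 ≤ p j) (hp1 : ∀ j, p j ≤ 1) :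
    a * (1 - ∏ j, (1 - p j)) ≤
      ∑ i, p i * ∫ u in (0 : ℝ)..a, ∏ j ∈ Finset.univ.erase i, (1 - u * p j) := by
  have h := sum_mul_integral_prod_erase (fun _ => 1) p 0 a
  have h' := prod_affine_le_affine_prod Finset.univ h0 le_rfl (by linarith) hp (fun _ => le_rfl) hp1
  simp only [sub_zero, Finset.prod_const_one, zero_mul, add_zero] at h h'
  linarith

/-- The second phase starts from the product at which the first ends, so the two sums telescope to 1
- ∏ (1 - a p j - (1 - a) r j). -/
lemma le_sum_both_phases (h0 : 0 ≤ a) (h1 : a ≤ 1) (hp : ∀ j, 0 ≤ p j) (hpr : ∀ j, p j ≤ r j)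
    (hr1 : ∀ j, r j ≤ 1) :
    1 - a * ∏ j, (1 - p j) - (1 - a) * ∏ j, (1 - r j) ≤
      ∑ i, p i * (∫ u in (0 : ℝ)..a, ∏ j ∈ Finset.univ.erase i, (1 - u * p j)) +
        ∑ i, r i * ∫ u in a..1, ∏ j ∈ Finset.univ.erase i, (1 - a * p j - (u - a) * r j) := by
  have h := sum_mul_integral_prod_erase (fun _ => 1) p 0 a
  have h2 := sum_mul_integral_prod_erase (fun j => 1 - a * p j) r a 1
  have h' := prod_affine_le_affine_prod Finset.univ h0 (sub_nonneg.2 h1) (by linarith) hp hpr hr1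
  simp only [sub_zero, Finset.prod_const_one] at h
  linarith

end Phases

/-- Split v₁ S₁ + v₂ S₂ as v₂ (S₁ + S₂) + (v₁ - v₂) S₁ and c B₂ as I₂ B₂ + (c - I₂) B₂. The bound on
B₂ turns the last term into (c - I₂) B₁, covered by I₁ B₁, plus a multiple of v₁ - v₂, covered by k
through `hkc`. -/
lemma combine_phases {c k I₁ I₂ P v₁ v₂ ε S₁ S₂ B B₁ B₂ : ℝ}
    (hc : 0 ≤ c) (hv₂ : 0 ≤ v₂) (hv : v₂ ≤ v₁) (hB₁ : 0 ≤ B₁)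
    (hI : c ≤ I₁ + I₂) (hI₂ : I₂ ≤ c) (hk : k ≤ S₁) (hS : c ≤ S₁ + S₂)
    (hkc : c * (1 - P) ≤ k + I₂ * (1 - P))
    (hB : B ≤ v₂ + ε + B₂) (hB₂ : B₂ ≤ B₁ + (v₁ - v₂) * (1 - P)) :
    c * (B - ε) ≤ v₁ * S₁ + v₂ * S₂ + I₁ * B₁ + I₂ * B₂ := by
  have e1 : c * (B - ε) ≤ c * (v₂ + B₂) := mul_le_mul_of_nonneg_left (by linarith) hc
  have e2 := mul_le_mul_of_nonneg_left hS hv₂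
  have e3 := mul_le_mul_of_nonneg_left hk (sub_nonneg.2 hv)
  have e4 := mul_le_mul_of_nonneg_left hkc (sub_nonneg.2 hv)
  have e5 := mul_le_mul_of_nonneg_left hI hB₁
  have e6 := mul_le_mul_of_nonneg_left hB₂ (sub_nonneg.2 hI₂)
  nlinarith

lemma two_phase_numerics :
    0.64 ≤ (1 - Real.exp (-(0.9 * (1 / 2)))) / 0.9 +
        Real.exp (-(0.9 * (1 / 2))) * ((1 - Real.exp (-(1.2 * (1 - 1 / 2)))) / 1.2) ∧
      Real.exp (-(0.9 * (1 / 2))) * ((1 - Real.exp (-(1.2 * (1 - 1 / 2)))) / 1.2) ≤ 0.64 ∧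
      0.64 * (1 - Real.exp (-1.2)) ≤ 1 / 2 * (1 - Real.exp (-0.9)) +
        Real.exp (-(0.9 * (1 / 2))) * ((1 - Real.exp (-(1.2 * (1 - 1 / 2)))) / 1.2) *
          (1 - Real.exp (-1.2)) ∧
      0.64 ≤ 1 - 1 / 2 * Real.exp (-0.9) - (1 - 1 / 2) * Real.exp (-1.2) := by
  -- All exponents 0.45, 0.6, 0.9 and 1.2 are multiples of 0.15, so one enclosure of z settles every
  -- inequality.
  set z := Real.exp (-0.15) with hz
  have hexp : Real.exp 0.15 * z = 1 := by rw [hz, ← Real.exp_add]; norm_num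
  have hlo : (1.161833 : ℝ) ≤ Real.exp 0.15 := by
    refine le_trans ?_ (Real.sum_le_exp_of_nonneg (by norm_num) 5)
    norm_num [Finset.sum_range_succ, Nat.factorial]
  have hhi : Real.exp 0.15 ≤ 1.161836 := by
    refine (Real.exp_bound' (n := 5) (by norm_num) (by norm_num) (by norm_num)).trans ?_
    norm_num [Finset.sum_range_succ, Nat.factorial]
  have hz0 : 0 < z := Real.exp_pos _
  have z1 : 0.8607 ≤ z := by nlinarith
  have z2 : z ≤ 0.86071 := by nlinarith
  have pow_eq (m : ℕ) (x : ℝ) (hx : x = m * -0.15) : Real.exp x = z ^ m := by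
    rw [hx, Real.exp_nat_mul]
  rw [pow_eq 3 (-(0.9 * (1 / 2))) (by norm_num), pow_eq 4 (-(1.2 * (1 - 1 / 2))) (by norm_num),
    pow_eq 6 (-0.9) (by norm_num), pow_eq 8 (-1.2) (by norm_num)]
  have lo (m : ℕ) : (0.8607 : ℝ) ^ m ≤ z ^ m := pow_le_pow_left₀ (by norm_num) z1 m
  have hi (m : ℕ) : z ^ m ≤ (0.86071 : ℝ) ^ m := pow_le_pow_left₀ hz0.le z2 m
  have l3 := lo 3
  have l4 := lo 4
  have l6 := lo 6
  have l8 := lo 8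
  have h3 := hi 3
  have h4 := hi 4
  have h6 := hi 6
  have h8 := hi 8
  norm_num at l3 l4 l6 l8 h3 h4 h6 h8
  have I_lo : 0.2395 ≤ z ^ 3 * ((1 - z ^ 4) / 1.2) := by
    refine le_trans ?_ (mul_le_mul l3 (div_le_div_of_nonneg_right (sub_le_sub_left h4 1)
      (by norm_num)) (by norm_num) (by positivity))
    norm_num
  have I_hi : z ^ 3 * ((1 - z ^ 4) / 1.2) ≤ 0.64 := by
    refine (mul_le_mul h3 (div_le_div_of_nonneg_right (sub_le_sub_left l4 1)
      (by norm_num)) (div_nonneg (by linarith) (by norm_num)) (by norm_num)).trans ?_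
    norm_num
  refine ⟨?_, I_hi, ?_, by linarith⟩
  · have : (0.4025 : ℝ) ≤ (1 - z ^ 3) / 0.9 := by rw [le_div_iff₀ (by norm_num)]; linarith
    linarith
  · have := mul_le_mul_of_nonneg_right I_lo (show 0 ≤ 1 - z ^ 8 by linarith)
    linarith

lemma exists_twoPhase_bound {n : ℕ} [NeZero n] (X : Instance n) (hX : X.benchmark ≠ ∞) {ε : ℝ≥0}
    (hε : 0 < ε) :
    ∃ μ : Measure (ℝ × ℝ≥0), IsProbabilityMeasure μ ∧
      ENNReal.ofReal (0.64 * (X.benchmark.toReal - ε)) ≤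
        ∫⁻ s, ∫⁻ x, markedProfit (fun i => (s i, x i)) ∂X.law ∂(Measure.pi fun _ => μ) := by
  obtain ⟨v₁, v₂, ν₁, ν₂, hν₁, hν₂, hs₁, hs₂, hv, hP₁, hP₂, hpr⟩ := exists_thresholdLaws X hε
    (Real.exp_pos (-1.2)) (Real.exp_lt_exp.2 (show (-1.2 : ℝ) < -0.9 by norm_num))
    (by rw [Real.exp_lt_one_iff]; norm_num)
  have h0 : (0 : ℝ) ≤ 1 / 2 := by norm_num
  have h1 : (1 / 2 : ℝ) ≤ 1 := by norm_num
  refine ⟨twoPhase (1 / 2) ν₁ ν₂, isProbabilityMeasure_twoPhase h0 h1 ν₁ ν₂, ?_⟩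
  rw [lintegral_markedProfit_twoPhase X h0 h1]
  have hp (j : Fin n) := acceptProb_nonneg ν₁ (X j)
  have hp1 (j : Fin n) := acceptProb_le_one ν₁ (X j)
  have hr (j : Fin n) := acceptProb_nonneg ν₂ (X j)
  have hr1 (j : Fin n) := acceptProb_le_one ν₂ (X j)
  set J₁ : Fin n → ℝ := fun i => ∫ u in (0 : ℝ)..1 / 2,
    ∏ j ∈ Finset.univ.erase i, (1 - u * acceptProb ν₁ (X j))
  set J₂ : Fin n → ℝ := fun i => ∫ u in (1 / 2 : ℝ)..1, ∏ j ∈ Finset.univ.erase i,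
    (1 - 1 / 2 * acceptProb ν₁ (X j) - (u - 1 / 2) * acceptProb ν₂ (X j))
  set I₁ : ℝ := (1 - Real.exp (-(0.9 * (1 / 2)))) / 0.9
  set I₂ : ℝ := Real.exp (-(0.9 * (1 / 2))) * ((1 - Real.exp (-(1.2 * (1 - 1 / 2)))) / 1.2)
  have hJ₁ (i : Fin n) : I₁ ≤ J₁ i :=
    le_integral_first_phase i h0 h1 (by norm_num) hp hp1 hP₁
  have hJ₂ (i : Fin n) : I₂ ≤ J₂ i :=
    le_integral_second_phase i h0 h1 (by norm_num) hp hp1 hr hr1 hP₁ hP₂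
  have hS₁ : 1 / 2 * (1 - Real.exp (-0.9)) ≤ ∑ i, acceptProb ν₁ (X i) * J₁ i := by
    rw [← hP₁]; exact le_sum_first_phase h0 h1 hp hp1
  have hS : 1 - 1 / 2 * Real.exp (-0.9) - (1 - 1 / 2) * Real.exp (-1.2) ≤
      ∑ i, acceptProb ν₁ (X i) * J₁ i + ∑ i, acceptProb ν₂ (X i) * J₂ i := by
    rw [← hP₁, ← hP₂]; exact le_sum_both_phases h0 h1 hp hpr hr1
  obtain ⟨hI, hI₂, hkc, hc⟩ : 0.64 ≤ I₁ + I₂ ∧ I₂ ≤ 0.64 ∧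
      0.64 * (1 - Real.exp (-1.2)) ≤ 1 / 2 * (1 - Real.exp (-0.9)) + I₂ * (1 - Real.exp (-1.2)) ∧
      0.64 ≤ 1 - 1 / 2 * Real.exp (-0.9) - (1 - 1 / 2) * Real.exp (-1.2) := two_phase_numerics
  have hI₁0 : 0 ≤ I₁ := div_nonneg (sub_nonneg.2 (Real.exp_le_one_iff.2 (by norm_num))) (by norm_num)
  have hI₂0 : 0 ≤ I₂ := mul_nonneg (Real.exp_pos _).le
    (div_nonneg (sub_nonneg.2 (Real.exp_le_one_iff.2 (by norm_num))) (by norm_num))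
  set e : ℝ≥0 → Fin n → ℝ≥0∞ := fun m i => ∫⁻ y, ((y - m : ℝ≥0) : ℝ≥0∞) ∂(X i : Measure ℝ≥0)
    with he
  have hfin (m : ℝ≥0) : X.excess m ≠ ∞ := ne_top_of_le_ne_top hX (excess_le_benchmark X m)
  have hefin (m : ℝ≥0) (i : Fin n) : e m i ≠ ∞ :=
    ne_top_of_le_ne_top (hfin m) (lintegral_tsub_le_excess X m i)
  have hsum (m : ℝ≥0) : (X.excess m).toReal ≤ ∑ i, (e m i).toReal := by
    rw [← ENNReal.toReal_sum fun i _ => hefin m i]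
    exact ENNReal.toReal_mono (ENNReal.sum_ne_top.2 fun i _ => hefin m i) (excess_le_sum X m)
  have hB : X.benchmark.toReal ≤ v₂ + ε + (X.excess (v₂ + ε)).toReal := by
    have := ENNReal.toReal_mono (by finiteness [hfin (v₂ + ε)]) (benchmark_le X (v₂ + ε))
    rwa [ENNReal.toReal_add (by finiteness) (hfin _), ENNReal.coe_toReal, NNReal.coe_add] at this
  have hB₂ : (X.excess (v₂ + ε)).toReal ≤
      (X.excess (v₁ + ε)).toReal + (v₁ - v₂) * (1 - Real.exp (-1.2)) := by
    -- A value above v₂ + ε is accepted by every threshold in the support of `ν₂`, so exceeding that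
    -- level is no likelier than acceptance.
    have hle : Real.exp (-1.2) ≤ ∏ j, (1 - (X j : Measure ℝ≥0).real (Set.Ioi (v₂ + ε))) := by
      rw [← hP₂]
      refine Finset.prod_le_prod (fun j _ => sub_nonneg.2 (hr1 j)) fun j _ => ?_
      exact sub_le_sub_left (measureReal_Ioi_le_acceptProb hs₂) 1
    have hx : 0 ≤ 1 - Real.exp (-1.2) := sub_nonneg.2 (Real.exp_le_one_iff.2 (by norm_num))
    have := ENNReal.toReal_mono (by finiteness [hfin (v₁ + ε)])
      (excess_le_excess_add X (m₁ := v₁ + ε) hle)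
    rwa [ENNReal.toReal_add (hfin _) (by finiteness), ENNReal.toReal_mul, ENNReal.coe_toReal,
      ENNReal.toReal_ofReal hx, add_tsub_add_eq_tsub_right, NNReal.coe_sub hv] at this
  have hterm {ν : Measure ℝ≥0} [IsProbabilityMeasure ν] {v : ℝ≥0}
      (hs : ∀ᵐ θ ∂ν, θ ∈ Set.Icc v (v + ε)) (i : Fin n) (J : ℝ) :
      ENNReal.ofReal ((v * acceptProb ν (X i) + (e (v + ε) i).toReal) * J) ≤
        acceptedValue ν (X i) * ENNReal.ofReal J := by
    have hx := mul_nonneg v.coe_nonneg (acceptProb_nonneg ν (X i))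
    rw [ENNReal.ofReal_mul (add_nonneg hx ENNReal.toReal_nonneg),
      ENNReal.ofReal_add hx ENNReal.toReal_nonneg, ENNReal.ofReal_mul v.coe_nonneg,
      ENNReal.ofReal_toReal (hefin _ i), ENNReal.ofReal_coe_nnreal]
    exact mul_le_mul_left (le_acceptedValue hs) _
  have hnn {ν : Measure ℝ≥0} (v : ℝ≥0) (i : Fin n) {J : ℝ} (hJ : 0 ≤ J) :
      0 ≤ (v * acceptProb ν (X i) + (e (v + ε) i).toReal) * J :=
    mul_nonneg (add_nonneg (mul_nonneg v.coe_nonneg (acceptProb_nonneg ν (X i)))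
      ENNReal.toReal_nonneg) hJ
  calc ENNReal.ofReal (0.64 * (X.benchmark.toReal - ε))
      ≤ ENNReal.ofReal (∑ i, ((v₁ * acceptProb ν₁ (X i) + (e (v₁ + ε) i).toReal) * J₁ i +
          (v₂ * acceptProb ν₂ (X i) + (e (v₂ + ε) i).toReal) * J₂ i)) :=
        ENNReal.ofReal_le_ofReal ?_
    _ = ∑ i, (ENNReal.ofReal ((v₁ * acceptProb ν₁ (X i) + (e (v₁ + ε) i).toReal) * J₁ i) +
          ENNReal.ofReal ((v₂ * acceptProb ν₂ (X i) + (e (v₂ + ε) i).toReal) * J₂ i)) := by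
        rw [ENNReal.ofReal_sum_of_nonneg fun i _ => add_nonneg
          (hnn v₁ i (hI₁0.trans (hJ₁ i))) (hnn v₂ i (hI₂0.trans (hJ₂ i)))]
        exact Finset.sum_congr rfl fun i _ => ENNReal.ofReal_add
          (hnn v₁ i (hI₁0.trans (hJ₁ i))) (hnn v₂ i (hI₂0.trans (hJ₂ i)))
    _ ≤ _ := Finset.sum_le_sum fun i _ => add_le_add (hterm hs₁ i (J₁ i)) (hterm hs₂ i (J₂ i))
  have hE {m : ℝ≥0} {I : ℝ} {J : Fin n → ℝ} (hI0 : 0 ≤ I) (hJ : ∀ i, I ≤ J i) :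
      I * (X.excess m).toReal ≤ ∑ i, (e m i).toReal * J i := by
    refine (mul_le_mul_of_nonneg_left (hsum m) hI0).trans ?_
    rw [Finset.mul_sum]
    refine Finset.sum_le_sum fun i _ => ?_
    rw [mul_comm]
    exact mul_le_mul_of_nonneg_left (hJ i) ENNReal.toReal_nonneg
  refine (combine_phases (by norm_num) v₂.coe_nonneg (NNReal.coe_le_coe.2 hv)
    ENNReal.toReal_nonneg hI hI₂ hS₁ (hc.trans hS) hkc hB hB₂).trans ?_
  have e₁ := hE (m := v₁ + ε) hI₁0 hJ₁
  have e₂ := hE (m := v₂ + ε) hI₂0 hJ₂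
  simp only [add_mul, Finset.sum_add_distrib, mul_assoc, ← Finset.mul_sum]
  linarith

/-! ### Infinite benchmarks and the conclusion -/

lemma lintegral_profit_zero {n : ℕ} [NeZero n] (X : Instance n) (σ : Equiv.Perm (Fin n)) :
    ∫⁻ y, (y : ℝ≥0∞) ∂(X (σ 0) : Measure ℝ≥0) ≤ ∫⁻ x, (profit 0 σ x : ℝ≥0∞) ∂X.law := by
  rw [← lintegral_eval X measurable_coe_nnreal_ennreal]
  refine lintegral_mono fun x => ENNReal.coe_le_coe.2 ?_
  have h : roundProfit 0 σ x 0 = x (σ 0) := if_pos ⟨zero_le, fun j hj => absurd hj (by simp)⟩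
  rw [← h]
  exact Finset.single_le_sum (f := roundProfit 0 σ x) (fun _ _ => zero_le) (Finset.mem_univ 0)

lemma exists_lintegral_eq_top {n : ℕ} (X : Instance n) (hX : X.benchmark = ∞) :
    ∃ i, ∫⁻ y, (y : ℝ≥0∞) ∂(X i : Measure ℝ≥0) = ∞ := by
  have h := excess_le_sum X 0
  simp only [Instance.excess, tsub_zero] at h
  rw [← Instance.benchmark, hX, top_le_iff, ENNReal.sum_eq_top] at h
  obtain ⟨i, -, hi⟩ := h
  exact ⟨i, hi⟩

/-- On every instance some thresholds collect a `0.636` fraction of the expected maximum. -/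
lemma exists_competitive_thresholds {n : ℕ} (X : Instance n) :
    ∃ α : Fin n → ℝ≥0, ENNReal.ofReal 0.636 * X.benchmark ≤
      (∑ σ : Equiv.Perm (Fin n), ∫⁻ x, (profit α σ x : ℝ≥0∞) ∂X.law) / (n.factorial : ℝ≥0∞) := by
  rcases eq_or_ne X.benchmark 0 with hX0 | hX0
  · exact ⟨0, by simp [hX0]⟩
  have hn : NeZero n := ⟨by
    rintro rfl
    exact hX0 (by simp [Instance.benchmark])⟩
  rcases eq_or_ne X.benchmark ∞ with hX | hX
  -- Zero thresholds take the first arrival. Some sample has infinite mean, and a single order that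
  -- brings it first already makes the average infinite.
  · refine ⟨0, le_of_le_of_eq le_top ?_⟩
    obtain ⟨i, hi⟩ := exists_lintegral_eq_top X hX
    have h := lintegral_profit_zero X (Equiv.swap 0 i)
    rw [Equiv.swap_apply_left, hi, top_le_iff] at h
    have hsum : ∑ σ : Equiv.Perm (Fin n), ∫⁻ x, (profit 0 σ x : ℝ≥0∞) ∂X.law = ∞ :=
      ENNReal.sum_eq_top.2 ⟨_, Finset.mem_univ _, h⟩
    rw [hsum, ENNReal.top_div_of_ne_top (ENNReal.natCast_ne_top _)]
  have hpos : 0 < X.benchmark.toReal := ENNReal.toReal_pos hX0 hX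
  -- With ε equal to 1/200 of the benchmark, the guaranteed rate is 0.64 * (1 - 1/200) = 0.6368,
  -- leaving the strict gap above 0.636 that derandomization needs.
  obtain ⟨μ, hμ, h⟩ := exists_twoPhase_bound X hX
    (ε := (X.benchmark / 200).toNNReal) (ENNReal.toNNReal_pos (by simp [hX0]) (by finiteness))
  refine exists_thresholds X μ (lt_of_lt_of_le ?_ h)
  rw [← ENNReal.ofReal_toReal hX, ← ENNReal.ofReal_mul (by norm_num), ENNReal.ofReal_toReal hX,
    ENNReal.coe_toNNReal_eq_toReal, ENNReal.toReal_div]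
  refine (ENNReal.ofReal_lt_ofReal_iff_of_nonneg (by positivity)).2 ?_
  norm_num
  linarith

end ProphetSecretary

theorem theorem1 :
    ∃ A : ProphetSecretary.Algorithm,
      ∃ c : ℝ, 1 - 1 / Real.exp 1 + 1 / 400 < c ∧ A.IsCompetitive c := by
  choose α hα using fun n => ProphetSecretary.exists_competitive_thresholds (n := n)
  refine ⟨⟨α⟩, 0.636, ?_, hα⟩
  have h := Real.exp_one_lt_d9
  have : 0.3667 < 1 / Real.exp 1 := by
    rw [lt_div_iff₀ (Real.exp_pos 1)]
    linarith
  linarith
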